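/- Let $G$ be a finite group and let $\operatorname{Irr} G$ be the set of its irreducible complex characters. For $X\subseteq \operatorname{Irr} G$ put $\sigma_X=\sum_{\chi\in X}\chi(1)\chi$. For $K\subseteq G$ put $\hat K=\sum_{g\in K} g\in\mathbb{C}G$, and extend every $\chi\in\operatorname{Irr}G$ linearly to the group algebra $\mathbb{C}G$. For a set $\mathcal{X}$ of subsets of $\operatorname{Irr}G$, let $\operatorname{ClPt}(\mathcal{X})$ be the partition of $G$ into the equivalence classes of the relation: $g\sim h$ if and only if $\sigma_X(g)=\sigma_X(h)$ for all $X\in\mathcal{X}$. For a set $\mathcal{K}$ of subsets of $G$ each of which is a union of conjugacy classes, let $\operatorname{IrPt}(\mathcal{K})$ be the partition of $\operatorname{Irr}G$ into the equivalence classes of the relation: $\chi\sim\psi$ if and only if $\chi(\hat K)/\chi(1)=\psi(\hat K)/\psi(1)$ for all $K\in\mathcal{K}$. (The members of $\operatorname{ClPt}(\mathcal{X})$ are unions of conjugacy classes, so $\operatorname{IrPt}(\operatorname{ClPt}(\mathcal{X}))$ is defined.) **Theorem.** Let $\mathcal{X}$ be a partition of $\operatorname{Irr}G$. Then the following are equivalent: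 1. $|\mathcal{X}|=|\operatorname{ClPt}(\mathcal{X})|$; 2. the complex linear span, in the space of class functions on $G$, of the characters $\sigma_X$ for $X\in\mathcal{X}$ is a unital subalgebra of the algebra of all complex class functions on $G$ (with pointwise operations, and with the same unit, the constant function $1$); 3. $\mathcal{X}=\operatorname{IrPt}(\operatorname{ClPt}(\mathcal{X}))$. -/

import Mathlib

namespace SCT

universe u

section

variable {G : Type u} [Group G]

/-- `χ : G → ℂ` is an irreducible complex character: the character of an irreducible
representation on some `ℂⁿ`. Up to isomorphism these are all the finite-dimensional
irreducible complex representations (see `isIrrChar_character`). -/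
def IsIrrChar (χ : G → ℂ) : Prop :=
  ∃ (n : ℕ) (ρ : Representation ℂ G (Fin n → ℂ)), ρ.IsIrreducible ∧ ρ.character = χ

/-- The character of any finite-dimensional irreducible complex representation is an
irreducible character in the above sense. -/
theorem isIrrChar_character {V : Type*} [AddCommGroup V] [Module ℂ V]
    [FiniteDimensional ℂ V] (ρ : Representation ℂ G V) (hρ : ρ.IsIrreducible) :
    IsIrrChar ρ.character := by
  let e : V ≃ₗ[ℂ] (Fin (Module.finrank ℂ V) → ℂ) := (Module.finBasis ℂ V).equivFun
  let τ : Representation ℂ G (Fin (Module.finrank ℂ V) → ℂ) :=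
    { toFun := fun g => e.conj (ρ g)
      map_one' := by ext; simp
      map_mul' := fun g h => by ext; simp [LinearEquiv.conj_apply] }
  let φ : Subrepresentation τ ≃o Subrepresentation ρ :=
    { toFun := fun S => ⟨S.toSubmodule.comap e.toLinearMap, fun g v hv => by
        have := S.apply_mem_toSubmodule g hv
        simpa [τ, LinearEquiv.conj_apply] using this⟩
      invFun := fun S => ⟨S.toSubmodule.comap e.symm.toLinearMap, fun g v hv => by
        have := S.apply_mem_toSubmodule g hv
        simpa [τ, LinearEquiv.conj_apply] using this⟩
      left_inv := fun S => by ext; simp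
      right_inv := fun S => by ext; simp
      map_rel_iff' := fun {S T} => by
        refine ⟨fun h v hv => ?_, fun h v hv => h hv⟩
        have := @h (e.symm v) (by
          change e (e.symm v) ∈ S.toSubmodule
          rwa [e.apply_symm_apply])
        change e (e.symm v) ∈ T.toSubmodule at this
        rwa [e.apply_symm_apply] at this }
  refine ⟨_, τ, φ.isSimpleOrder_iff.2 hρ, ?_⟩
  ext g
  exact LinearMap.trace_conj' (ρ g) e

end

/-- `Irr G`, the set of irreducible complex characters of `G`, as a type. -/
abbrev Irr (G : Type u) [Group G] : Type u := {χ : G → ℂ // IsIrrChar χ}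

section

variable {G : Type u} [Group G]

open scoped Classical in
theorem irr_orthogonal [Fintype G] (χ ψ : Irr G) :
    (Nat.card G : ℂ)⁻¹ * ∑ g : G, χ.1 g * ψ.1 g⁻¹ = if χ = ψ then 1 else 0 := by
  classical
  obtain ⟨χ, n, ρ, hρ, rfl⟩ := χ
  obtain ⟨ψ, m, τ, hτ, rfl⟩ := ψ
  have : Invertible (Nat.card G : ℂ) := invertibleOfNonzero (by simp)
  have key := Representation.char_orthonormal ρ τ
  by_cases h : ρ.character = τ.character
  · have key2 := Representation.char_orthonormal ρ ρ
    rw [if_pos ⟨Representation.Equiv.refl ρ⟩] at key2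
    rw [if_pos (Subtype.ext h)]
    change _ * ∑ g : G, ρ.character g * τ.character g⁻¹ = 1
    rw [← h]
    exact key2
  · rw [if_neg (fun ⟨φ⟩ => h (Representation.char_iso φ).symm)] at key
    rw [if_neg (fun e => h (congrArg Subtype.val e))]
    exact key

theorem irr_linearIndependent [Fintype G] :
    LinearIndependent ℂ (fun χ : Irr G => χ.1) := by
  classical
  rw [linearIndependent_iff']
  intro s c hc ψ hψ
  have h : ∑ χ ∈ s, c χ * ((Nat.card G : ℂ)⁻¹ * ∑ g : G, χ.1 g * ψ.1 g⁻¹) = 0 := by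
    have : ∀ g : G, ∑ χ ∈ s, c χ * χ.1 g = 0 := fun g => by
      simpa using congrFun hc g
    calc _ = (Nat.card G : ℂ)⁻¹ * ∑ g : G, (∑ χ ∈ s, c χ * χ.1 g) * ψ.1 g⁻¹ := by
          simp only [Finset.mul_sum, Finset.sum_mul]
          rw [Finset.sum_comm]
          refine Finset.sum_congr rfl fun _ _ => Finset.sum_congr rfl fun _ _ => by ring
      _ = 0 := by simp [this]
  simp only [irr_orthogonal] at h
  simpa [hψ] using h

instance irrFinite [Finite G] : Finite (Irr G) :=
  have := Fintype.ofFinite G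
  irr_linearIndependent.finite

noncomputable instance irrFintype [Finite G] : Fintype (Irr G) := Fintype.ofFinite _

end

/-- The algebra `cf(G)` of complex class functions on `G`, with pointwise operations. -/
def ClassFunction (G : Type u) [Group G] : Subalgebra ℂ (G → ℂ) where
  carrier := {f | ∀ g h : G, IsConj g h → f g = f h}
  mul_mem' ha hb g h c := by simp [ha g h c, hb g h c]
  add_mem' ha hb g h c := by simp [ha g h c, hb g h c]
  algebraMap_mem' _ _ _ _ := rfl

section

variable {G : Type u} [Group G]

theorem IsIrrChar.mem_classFunction {χ : G → ℂ} (hχ : IsIrrChar χ) :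
    χ ∈ ClassFunction G := by
  obtain ⟨n, ρ, -, rfl⟩ := hχ
  intro g h c
  obtain ⟨x, rfl⟩ := isConj_iff.1 c
  exact (ρ.char_conj g x).symm

/-- An irreducible character, as a class function. -/
def Irr.toClassFunction (χ : Irr G) : ClassFunction G := ⟨χ.1, χ.2.mem_classFunction⟩

open scoped Classical in
/-- `σ_X = ∑_{χ ∈ X} χ(1) χ` for `X ⊆ Irr G`. -/
noncomputable def sigma [Finite G] (X : Set (Irr G)) : ClassFunction G :=
  ∑ χ : Irr G with χ ∈ X, χ.1 1 • χ.toClassFunction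

/-- The relation `g ∼ h` iff `σ_X(g) = σ_X(h)` for all `X ∈ 𝓧`. -/
noncomputable def clSetoid [Finite G] (𝓧 : Set (Set (Irr G))) : Setoid G where
  r g h := ∀ X ∈ 𝓧, (sigma X).1 g = (sigma X).1 h
  iseqv := ⟨fun _ _ _ => rfl, fun H X hX => (H X hX).symm,
    fun H K X hX => (H X hX).trans (K X hX)⟩

/-- `ClPt(𝓧)`: the partition of `G` into the equivalence classes of `clSetoid 𝓧`. -/
noncomputable def ClPt [Finite G] (𝓧 : Set (Set (Irr G))) : Set (Set G) :=
  (clSetoid 𝓧).classes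

open scoped Classical in
/-- The block sum `K̂ = ∑_{g ∈ K} g` in the group algebra `ℂG`. -/
noncomputable def blockSum [Fintype G] (K : Set G) : MonoidAlgebra ℂ G :=
  ∑ g : G with g ∈ K, MonoidAlgebra.of ℂ G g

/-- The linear extension of a function `χ : G → ℂ` to the group algebra `ℂG`. -/
noncomputable def linExt [Fintype G] (χ : G → ℂ) (a : MonoidAlgebra ℂ G) : ℂ :=
  ∑ g : G, a.coeff g * χ g

/-- The relation `χ ∼ ψ` iff `χ(K̂)/χ(1) = ψ(K̂)/ψ(1)` for all `K ∈ 𝓚`. -/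
noncomputable def irSetoid [Fintype G] (𝓚 : Set (Set G)) : Setoid (Irr G) where
  r χ ψ := ∀ K ∈ 𝓚, linExt χ.1 (blockSum K) / χ.1 1 = linExt ψ.1 (blockSum K) / ψ.1 1
  iseqv := ⟨fun _ _ _ => rfl, fun H X hX => (H X hX).symm,
    fun H K X hX => (H X hX).trans (K X hX)⟩

/-- `IrPt(𝓚)`: the partition of `Irr G` into the equivalence classes of `irSetoid 𝓚`.
It is meant for collections `𝓚` of conjugation-invariant subsets of `G`, and
`ClPt 𝓧` is such a collection (see `conj_mem_of_mem_ClPt`). -/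
noncomputable def IrPt [Fintype G] (𝓚 : Set (Set G)) : Set (Set (Irr G)) :=
  (irSetoid 𝓚).classes

/-- The members of `ClPt 𝓧` are unions of conjugacy classes. -/
theorem conj_mem_of_mem_ClPt [Finite G] {𝓧 : Set (Set (Irr G))} {K : Set G}
    (hK : K ∈ ClPt 𝓧) {g h : G} (hg : g ∈ K) (c : IsConj g h) : h ∈ K := by
  obtain ⟨x, rfl⟩ := hK
  exact fun X hX => ((sigma X).2 g h c).symm.trans (hg X hX)

end

end SCT

/-! Write `𝓧` as the set of classes of a setoid `r` on `Irr G`. Let `V` be the span of the `σ_X`,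
and let `L` be the algebra of functions constant on the members of `ClPt 𝓧`. Each of the three
conditions is equivalent to `V = L`. The map `degreeSum` is injective and carries `levelFunctions r`
onto `V`, so `dim V = |𝓧|`. Also `V ≤ L` and `dim L = |ClPt 𝓧|`, which settles condition 1. For
condition 2, a unital subalgebra of functions on a finite set contains every function constant on
its common level sets (`levelFunctions_le_of_separates`), and those level sets for `V` are the
members of `ClPt 𝓧`. For condition 3, `centralValue` inverts `degreeSum` up to complex conjugation
and the factor `|G|` (`centralValue_star_degreeSum`), and it is injective on class functions because
irreducible characters span them. -/

namespace SCT

/-! ### Algebras of functions constant on classes -/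

section

variable {α : Type*}

/-- The algebra of complex functions that are constant on the classes of a setoid. -/
def levelFunctions (s : Setoid α) : Subalgebra ℂ (α → ℂ) where
  carrier := {f | ∀ a b, s a b → f a = f b}
  mul_mem' hf hg a b h := by simp [hf a b h, hg a b h]
  add_mem' hf hg a b h := by simp [hf a b h, hg a b h]
  algebraMap_mem' _ _ _ _ := rfl

theorem star_mem_levelFunctions {s : Setoid α} {f : α → ℂ} (hf : f ∈ levelFunctions s) :
    star f ∈ levelFunctions s :=
  fun a b h => congrArg star (hf a b h)

theorem finrank_levelFunctions [Finite α] (s : Setoid α) :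
    Module.finrank ℂ (Subalgebra.toSubmodule (levelFunctions s)) = s.classes.ncard := by
  classical
  have := Fintype.ofFinite α
  have h : Subalgebra.toSubmodule (levelFunctions s) =
      LinearMap.range (LinearMap.funLeft ℂ ℂ (Quotient.mk s)) := by
    ext f
    constructor
    · intro hf
      exact ⟨Quotient.lift f hf, rfl⟩
    · rintro ⟨f, rfl⟩ a b hab
      exact congrArg f (Quotient.sound hab)
  rw [h, LinearMap.finrank_range_of_inj
    (LinearMap.funLeft_injective_of_surjective _ _ _ Quotient.mk_surjective),
    Module.finrank_fintype_fun_eq_card, ← Nat.card_eq_fintype_card,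
    Nat.card_congr s.quotientEquivClasses]
  rfl

theorem indicator_mem_levelFunctions {s : Setoid α} {K : Set α} (hK : K ∈ s.classes) :
    K.indicator 1 ∈ levelFunctions s := by
  classical
  obtain ⟨c, rfl⟩ := hK
  intro a b h
  have : s a c ↔ s b c := ⟨fun k => s.trans (s.symm h) k, fun k => s.trans h k⟩
  simp [Set.indicator_apply, this]

theorem eq_sum_indicator_classes {s : Setoid α} [Fintype (Quotient s)] {f : α → ℂ}
    (hf : f ∈ levelFunctions s) :
    f = ∑ q : Quotient s, f q.out • {a | s a q.out}.indicator (1 : α → ℂ) := by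
  ext a
  rw [Finset.sum_apply, Finset.sum_eq_single (Quotient.mk s a)]
  · have h : s a (Quotient.mk s a).out := s.symm (Quotient.mk_out a)
    simp [h, hf _ _ h]
  · intro q _ hq
    have : ¬ s a q.out := fun h => hq (by rw [← Quotient.out_eq q]; exact Quotient.sound (s.symm h))
    simp [this]
  · simp

theorem span_indicator_classes [Finite α] (s : Setoid α) :
    Submodule.span ℂ ((fun K : Set α => K.indicator (1 : α → ℂ)) '' s.classes) =
      Subalgebra.toSubmodule (levelFunctions s) := by
  have := Fintype.ofFinite (Quotient s)
  apply le_antisymm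
  · rw [Submodule.span_le]
    rintro _ ⟨K, hK, rfl⟩
    exact indicator_mem_levelFunctions hK
  · intro f hf
    rw [eq_sum_indicator_classes hf]
    exact Submodule.sum_mem _ fun q _ => Submodule.smul_mem _ _
      (Submodule.subset_span ⟨_, s.mem_classes q.out, rfl⟩)

/-- A subalgebra of functions on a finite set consists of all functions that are constant on
its common level sets. -/
theorem levelFunctions_le_of_separates [Finite α] (s : Setoid α) (A : Subalgebra ℂ (α → ℂ))
    (hA : A ≤ levelFunctions s) (hs : ∀ a b, (∀ f ∈ A, f a = f b) → s a b) :
    levelFunctions s ≤ A := by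
  classical
  have := Fintype.ofFinite α
  have := Fintype.ofFinite (Quotient s)
  have sep : ∀ a b, ¬ s a b → ∃ f ∈ A, f a = 1 ∧ f b = 0 := by
    intro a b hab
    obtain ⟨f, hf, hne⟩ : ∃ f ∈ A, f a ≠ f b := by
      by_contra! h
      exact hab (hs a b h)
    refine ⟨(f a - f b)⁻¹ • (f - algebraMap ℂ _ (f b)),
      A.smul_mem (A.sub_mem hf (A.algebraMap_mem _)) _, ?_, ?_⟩
    · simp [inv_mul_cancel₀ (sub_ne_zero.2 hne)]
    · simp
  choose! F hFA hF1 hF0 using sep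
  have hind : ∀ c, {a | s a c}.indicator (1 : α → ℂ) ∈ A := by
    intro c
    -- Lagrange interpolation: on the class of `c` every factor keeps its value 1 at `c`; at a point
    -- `a` outside it, the factor with `b = a` vanishes.
    have : {a | s a c}.indicator (1 : α → ℂ) = ∏ b : α with ¬ s c b, F c b := by
      ext a
      rw [Finset.prod_apply]
      by_cases h : s a c
      · rw [Set.indicator_of_mem (by exact h), Finset.prod_eq_one]
        · rfl
        · intro b hb
          have hb := (Finset.mem_filter.1 hb).2
          rw [hA (hFA c b hb) a c h, hF1 c b hb]
      · have h' : ¬ s c a := fun k => h (s.symm k)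
        rw [Set.indicator_of_notMem (by exact h)]
        have ha : a ∈ Finset.univ.filter fun b => ¬ s c b := by simpa using h'
        exact (Finset.prod_eq_zero (f := fun b => F c b a) ha (hF0 c a h')).symm
    rw [this]
    exact A.prod_mem fun b hb => hFA c b (Finset.mem_filter.1 hb).2
  intro f hf
  rw [eq_sum_indicator_classes hf]
  exact A.sum_mem fun q _ => A.smul_mem (hind _) _

end

/-! ### Degrees and complex conjugates of irreducible characters -/

section

variable {G : Type*} [Group G]

theorem IsIrrChar.apply_one_ne_zero {χ : G → ℂ} (hχ : IsIrrChar χ) : χ 1 ≠ 0 := by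
  obtain ⟨n, ρ, hρ, rfl⟩ := hχ
  rw [Representation.char_one, Module.finrank_fin_fun]
  rintro h
  obtain rfl : n = 0 := by exact_mod_cast h
  obtain ⟨S, T, hST⟩ := hρ.toNontrivial
  refine hST (SetLike.ext fun x => ?_)
  rw [Subsingleton.elim x 0]
  exact ⟨fun _ => T.toSubmodule.zero_mem, fun _ => S.toSubmodule.zero_mem⟩

theorem IsIrrChar.star_apply_one {χ : G → ℂ} (hχ : IsIrrChar χ) : star (χ 1) = χ 1 := by
  obtain ⟨n, ρ, hρ, rfl⟩ := hχ
  simp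

-- Unitary trick: the averaged form `P` is positive definite and invariant, so the adjoint of `M g`
-- is conjugate by `P` to `M g⁻¹` and has the same trace.
open Matrix ComplexOrder in
theorem IsIrrChar.star_apply [Finite G] {χ : G → ℂ} (hχ : IsIrrChar χ) (g : G) :
    star (χ g) = χ g⁻¹ := by
  classical
  have := Fintype.ofFinite G
  obtain ⟨n, ρ, -, rfl⟩ := hχ
  let M : G → Matrix (Fin n) (Fin n) ℂ := fun g => LinearMap.toMatrix' (ρ g)
  have hmul : ∀ a b, M (a * b) = M a * M b := fun a b => by
    simp only [M, map_mul]
    exact LinearMap.toMatrix'_mul _ _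
  have hone : M 1 = 1 := by simp [M]
  have htr : ∀ a, ρ.character a = (M a).trace := fun a =>
    LinearMap.trace_eq_matrix_trace ℂ (Pi.basisFun ℂ (Fin n)) (ρ a)
  let P : Matrix (Fin n) (Fin n) ℂ := ∑ a, (M a)ᴴ * M a
  have hP : P.PosDef := by
    have h : P = (M 1)ᴴ * M 1 + ∑ a ∈ Finset.univ.erase 1, (M a)ᴴ * M a :=
      (Finset.add_sum_erase _ _ (Finset.mem_univ 1)).symm
    rw [h, hone]
    simp only [conjTranspose_one, mul_one]
    exact PosDef.one.add_posSemidef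
      (posSemidef_sum _ fun a _ => posSemidef_conjTranspose_mul_self _)
  have hinv : (M g)ᴴ * P * M g = P := by
    simp only [P, Finset.mul_sum, Finset.sum_mul]
    refine Fintype.sum_equiv (Equiv.mulRight g) _ _ fun a => ?_
    simp [hmul, conjTranspose_mul, Matrix.mul_assoc]
  have hu : IsUnit P.det := (isUnit_iff_isUnit_det _).1 hP.isUnit
  have hgg : M g * M g⁻¹ = 1 := by rw [← hmul, mul_inv_cancel, hone]
  have key : (M g)ᴴ * P = P * M g⁻¹ := by
    calc (M g)ᴴ * P = (M g)ᴴ * P * (M g * M g⁻¹) := by rw [hgg, mul_one]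
      _ = P * M g⁻¹ := by rw [← Matrix.mul_assoc, hinv]
  rw [htr, htr, ← trace_conjTranspose]
  calc (M g)ᴴ.trace = ((M g)ᴴ * P * P⁻¹).trace := by
        rw [Matrix.mul_assoc, mul_nonsing_inv _ hu, mul_one]
    _ = (P⁻¹ * (P * M g⁻¹)).trace := by rw [key, trace_mul_comm]
    _ = (M g⁻¹).trace := by rw [← Matrix.mul_assoc, nonsing_inv_mul _ hu, one_mul]

end

open scoped MonoidAlgebra

/-! ### Completeness of the irreducible characters -/

section

variable {G : Type*} [Group G] [Fintype G]

theorem sum_smul_of_comm {f : G → ℂ} (hf : f ∈ ClassFunction G) (a : ℂ[G]) :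
    (∑ g, f g • MonoidAlgebra.of ℂ G g) * a = a * ∑ g, f g • MonoidAlgebra.of ℂ G g := by
  induction a using MonoidAlgebra.induction_on with
  | of h =>
    simp only [Finset.sum_mul, Finset.mul_sum, smul_mul_assoc, mul_smul_comm, ← map_mul]
    refine Fintype.sum_equiv (MulAut.conj h⁻¹).toEquiv _ _ fun g => ?_
    have : IsConj g (h⁻¹ * g * h) := isConj_iff.2 ⟨h⁻¹, by simp⟩
    simp [hf _ _ this, mul_assoc]
  | add a b ha hb => rw [mul_add, add_mul, ha, hb]
  | smul r a ha => rw [mul_smul_comm, smul_mul_assoc, ha]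

/-- By Schur's lemma the central element acts as a scalar; its trace is zero by hypothesis and the
dimension is nonzero, so the scalar is zero. -/
theorem asAlgebraHom_sum_smul_of_eq_zero {f : G → ℂ} (hf : f ∈ ClassFunction G)
    (h : ∀ χ : Irr G, ∑ g, f g * χ.1 g = 0) {V : Type*} [AddCommGroup V] [Module ℂ V]
    [FiniteDimensional ℂ V] (ρ : Representation ℂ G V) (hρ : ρ.IsIrreducible) :
    ρ.asAlgebraHom (∑ g, f g • MonoidAlgebra.of ℂ G g) = 0 := by
  set z := ∑ g, f g • MonoidAlgebra.of ℂ G g with hz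
  let φ : Representation.IntertwiningMap ρ ρ :=
    { toLinearMap := ρ.asAlgebraHom z
      isIntertwining' := fun g => by
        have := congrArg ρ.asAlgebraHom (sum_smul_of_comm hf (MonoidAlgebra.of ℂ G g))
        rw [map_mul, map_mul, Representation.asAlgebraHom_of] at this
        exact this }
  obtain ⟨c, hc⟩ :=
    (Representation.IsIrreducible.algebraMap_intertwiningMap_bijective_of_isAlgClosed).2 φ
  have hc' : ρ.asAlgebraHom z = c • LinearMap.id := by
    ext v
    exact (DFunLike.congr_fun hc v).symm
  have htr : LinearMap.trace ℂ V (ρ.asAlgebraHom z) = 0 := by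
    rw [hz, map_sum, map_sum, ← h ⟨_, isIrrChar_character ρ hρ⟩]
    refine Finset.sum_congr rfl fun g _ => ?_
    rw [map_smul, map_smul, Representation.asAlgebraHom_of]
    rfl
  have hd := (isIrrChar_character ρ hρ).apply_one_ne_zero
  rw [Representation.char_one] at hd
  rw [hc', map_smul, LinearMap.trace_id, smul_eq_mul] at htr
  rw [hc', (mul_eq_zero.1 htr).resolve_right hd, zero_smul]

theorem sum_smul_of_smul_eq_zero {f : G → ℂ} (hf : f ∈ ClassFunction G)
    (h : ∀ χ : Irr G, ∑ g, f g * χ.1 g = 0) {M : Type*} [AddCommGroup M] [Module ℂ M]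
    [Module ℂ[G] M] [IsScalarTower ℂ ℂ[G] M] [FiniteDimensional ℂ M] [IsSimpleModule ℂ[G] M]
    (x : M) : (∑ g, f g • MonoidAlgebra.of ℂ G g) • x = 0 := by
  let ρ : Representation ℂ G M := Representation.ofModule' M
  have hρ : ρ.asAlgebraHom = Algebra.lsmul ℂ ℂ M :=
    (MonoidAlgebra.lift ℂ (M →ₗ[ℂ] M) G).apply_symm_apply _
  let e : ρ.asModule ≃ₗ[ℂ[G]] M :=
    { ρ.asModuleEquiv.toAddEquiv with
      map_smul' := fun r x => DFunLike.congr_fun (DFunLike.congr_fun hρ r) (ρ.asModuleEquiv x) }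
  have hirr : ρ.IsIrreducible :=
    (Representation.irreducible_iff_isSimpleModule_asModule ρ).2 (IsSimpleModule.congr e)
  have hzero := asAlgebraHom_sum_smul_of_eq_zero hf h ρ hirr
  rw [hρ] at hzero
  exact DFunLike.congr_fun hzero x

/-- A class function orthogonal to all irreducible characters vanishes. -/
theorem eq_zero_of_sum_mul_irr_eq_zero {f : G → ℂ} (hf : f ∈ ClassFunction G)
    (h : ∀ χ : Irr G, ∑ g, f g * χ.1 g = 0) : f = 0 := by
  classical
  set z := ∑ g, f g • MonoidAlgebra.of ℂ G g with hz
  let N : Submodule ℂ[G] ℂ[G] :=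
    { carrier := {a | z * a = 0}
      zero_mem' := mul_zero z
      add_mem' := fun {a b} ha hb => by
        rw [Set.mem_ofPred_eq] at *
        rw [mul_add, ha, hb, add_zero]
      smul_mem' := fun c a ha => by
        rw [Set.mem_ofPred_eq] at *
        rw [smul_eq_mul, ← mul_assoc, hz, sum_smul_of_comm hf, mul_assoc, ha, mul_zero] }
  -- By Maschke's theorem the group algebra is the sum of its simple left ideals, each of which is
  -- killed by `z`. Then `z = z * 1 = 0`.
  have hN : N = ⊤ := by
    have : NeZero (Nat.card G : ℂ) := ⟨by simp⟩
    rw [eq_top_iff, ← IsSemisimpleModule.sSup_simples_eq_top ℂ[G] ℂ[G], sSup_le_iff]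
    intro S hS a ha
    have : IsSimpleModule ℂ[G] S := hS
    have : FiniteDimensional ℂ ℂ[G] := Module.Finite.of_basis (MonoidAlgebra.basis G ℂ)
    have : FiniteDimensional ℂ S :=
      Module.Finite.of_injective (S.subtype.restrictScalars ℂ) Subtype.val_injective
    exact congrArg Subtype.val (sum_smul_of_smul_eq_zero hf h (⟨a, ha⟩ : S))
  have hz0 : z = 0 := by
    have : (1 : ℂ[G]) ∈ N := hN ▸ Submodule.mem_top
    simpa [N] using this
  ext g
  have := congrArg (fun a : ℂ[G] => a.coeff g) hz0
  simpa [hz, Finsupp.single_apply] using this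

end

/-! ### The maps `degreeSum` and `centralValue` -/

section

variable {G : Type*} [Group G] [Fintype G]

/-- The linear map sending coefficients `a` to `∑ χ, a χ χ(1) χ`. -/
noncomputable def degreeSum : (Irr G → ℂ) →ₗ[ℂ] (G → ℂ) :=
  Fintype.linearCombination ℂ fun χ : Irr G => χ.1 1 • χ.1

theorem degreeSum_apply (a : Irr G → ℂ) (g : G) :
    degreeSum a g = ∑ χ : Irr G, a χ * (χ.1 1 * χ.1 g) := by
  simp [degreeSum, Fintype.linearCombination_apply]

theorem degreeSum_injective : Function.Injective (degreeSum (G := G)) := by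
  rw [← LinearMap.ker_eq_bot, LinearMap.ker_eq_bot']
  intro a ha
  have h : ∑ χ : Irr G, (a χ * χ.1 1) • χ.1 = 0 := by
    simpa [degreeSum, Fintype.linearCombination_apply, mul_smul] using ha
  ext χ
  have := Fintype.linearIndependent_iff.1 irr_linearIndependent _ h χ
  exact (mul_eq_zero.1 this).resolve_right χ.2.apply_one_ne_zero

theorem val_sigma (X : Set (Irr G)) : (sigma X).1 = degreeSum (X.indicator 1) := by
  classical
  ext g
  have : (sigma X).1 = ∑ χ : Irr G with χ ∈ X, χ.1 1 • χ.1 := by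
    change (ClassFunction G).val (sigma X) = _
    rw [sigma, map_sum]
    refine Finset.sum_congr (by congr) fun χ _ => rfl
  rw [this, degreeSum_apply, Finset.sum_filter, Finset.sum_apply]
  refine Finset.sum_congr rfl fun χ _ => ?_
  by_cases h : χ ∈ X <;> simp [h]

theorem map_span_sigma (r : Setoid (Irr G)) :
    (Submodule.span ℂ (sigma '' r.classes)).map (ClassFunction G).val.toLinearMap =
      (Subalgebra.toSubmodule (levelFunctions r)).map degreeSum := by
  rw [← span_indicator_classes, Submodule.map_span, Submodule.map_span, Set.image_image,
    Set.image_image]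
  congr 1
  exact Set.image_congr fun X _ => val_sigma X

theorem clSetoid_classes_iff (r : Setoid (Irr G)) {g h : G} :
    clSetoid r.classes g h ↔ ∀ a ∈ levelFunctions r, degreeSum a g = degreeSum a h := by
  constructor
  · intro H a ha
    have := Fintype.ofFinite (Quotient r)
    rw [eq_sum_indicator_classes ha, map_sum, Finset.sum_apply, Finset.sum_apply]
    refine Finset.sum_congr rfl fun q _ => ?_
    rw [map_smul, Pi.smul_apply, Pi.smul_apply, ← val_sigma, H _ (r.mem_classes q.out)]
  · intro H X hX
    rw [val_sigma]
    exact H _ (indicator_mem_levelFunctions hX)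

theorem map_degreeSum_le (r : Setoid (Irr G)) :
    (Subalgebra.toSubmodule (levelFunctions r)).map degreeSum ≤
      Subalgebra.toSubmodule (levelFunctions (clSetoid r.classes)) := by
  rintro _ ⟨a, ha, rfl⟩ g h H
  exact (clSetoid_classes_iff r).1 H a ha

theorem finrank_map_degreeSum (r : Setoid (Irr G)) :
    Module.finrank ℂ ((Subalgebra.toSubmodule (levelFunctions r)).map degreeSum) =
      r.classes.ncard := by
  rw [← finrank_levelFunctions]
  exact (Submodule.equivMapOfInjective _ degreeSum_injective _).finrank_eq.symm

theorem levelFunctions_clSetoid_le (𝓧 : Set (Set (Irr G))) :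
    levelFunctions (clSetoid 𝓧) ≤ ClassFunction G :=
  fun _ hf g h c => hf g h fun X _ => (sigma X).2 g h c

/-- The linear map sending `f` to the central character values
`χ ↦ (∑ g, f g χ(g)) / χ(1)` of `∑ g, f g • g`. -/
noncomputable def centralValue : (G → ℂ) →ₗ[ℂ] (Irr G → ℂ) where
  toFun f χ := (∑ g, f g * χ.1 g) / χ.1 1
  map_add' f f' := by
    ext χ
    simp [add_mul, Finset.sum_add_distrib, add_div]
  map_smul' c f := by
    ext χ
    simp [mul_assoc, ← Finset.mul_sum, mul_div_assoc]

theorem centralValue_apply (f : G → ℂ) (χ : Irr G) :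
    centralValue f χ = (∑ g, f g * χ.1 g) / χ.1 1 := rfl

theorem centralValue_injOn :
    Set.InjOn (centralValue (G := G)) (ClassFunction G : Set (G → ℂ)) := by
  intro f hf f' hf' h
  refine sub_eq_zero.1 (eq_zero_of_sum_mul_irr_eq_zero ((ClassFunction G).sub_mem hf hf') fun χ => ?_)
  have h0 : centralValue (f - f') χ = 0 := by rw [map_sub, h, sub_self]; rfl
  rw [centralValue_apply] at h0
  exact (div_eq_zero_iff.1 h0).resolve_right χ.2.apply_one_ne_zero

theorem linExt_blockSum_div (χ : Irr G) (K : Set G) :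
    linExt χ.1 (blockSum K) / χ.1 1 = centralValue (K.indicator 1) χ := by
  classical
  rw [centralValue_apply, linExt]
  congr 1
  refine Finset.sum_congr rfl fun g _ => ?_
  congr 1
  simp [blockSum, Finsupp.single_apply, Set.indicator_apply]

theorem irSetoid_classes_iff (s : Setoid G) {χ ψ : Irr G} :
    irSetoid s.classes χ ψ ↔
      ∀ f ∈ levelFunctions s, centralValue f χ = centralValue f ψ := by
  constructor
  · intro H f hf
    have := Fintype.ofFinite (Quotient s)
    rw [eq_sum_indicator_classes hf, map_sum, Finset.sum_apply, Finset.sum_apply]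
    refine Finset.sum_congr rfl fun q _ => ?_
    rw [map_smul, Pi.smul_apply, Pi.smul_apply, ← linExt_blockSum_div, ← linExt_blockSum_div,
      H _ (s.mem_classes q.out)]
  · intro H K hK
    rw [linExt_blockSum_div, linExt_blockSum_div]
    exact H _ (indicator_mem_levelFunctions hK)

/-- Row orthogonality: conjugation turns `ψ(g)` into `ψ(g⁻¹)`, and the degree weight `ψ(1)` cancels
the division by `χ(1)`. -/
theorem centralValue_star_degreeSum (a : Irr G → ℂ) :
    centralValue (star (degreeSum a)) = (Nat.card G : ℂ) • star a := by
  classical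
  ext χ
  have hN : (Nat.card G : ℂ) ≠ 0 := by simp
  have horth : ∀ ψ : Irr G, ∑ g, χ.1 g * ψ.1 g⁻¹ = if χ = ψ then (Nat.card G : ℂ) else 0 := by
    intro ψ
    have := irr_orthogonal χ ψ
    rw [inv_mul_eq_iff_eq_mul₀ hN] at this
    rw [this]
    split_ifs <;> simp
  rw [centralValue_apply, div_eq_iff χ.2.apply_one_ne_zero]
  calc ∑ g, star (degreeSum a) g * χ.1 g
      = ∑ g, ∑ ψ : Irr G, star (a ψ) * ψ.1 1 * (χ.1 g * ψ.1 g⁻¹) := by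
        refine Finset.sum_congr rfl fun g _ => ?_
        rw [Pi.star_apply, degreeSum_apply, star_sum, Finset.sum_mul]
        refine Finset.sum_congr rfl fun ψ _ => ?_
        rw [star_mul', star_mul', ψ.2.star_apply_one, ψ.2.star_apply]
        ring
    _ = ∑ ψ : Irr G, star (a ψ) * ψ.1 1 * ∑ g, χ.1 g * ψ.1 g⁻¹ := by
        rw [Finset.sum_comm]
        simp only [Finset.mul_sum]
    _ = _ := by
        simp only [horth, mul_ite, mul_zero, Finset.sum_ite_eq, Finset.mem_univ, if_true,
          Pi.smul_apply, Pi.star_apply, smul_eq_mul]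
        ring

/-! ### Each condition is equivalent to `V = L` -/

theorem encard_eq_iff_map_degreeSum_eq (r : Setoid (Irr G)) :
    r.classes.encard = (clSetoid r.classes).classes.encard ↔
      (Subalgebra.toSubmodule (levelFunctions r)).map degreeSum =
        Subalgebra.toSubmodule (levelFunctions (clSetoid r.classes)) := by
  rw [← (Set.toFinite r.classes).cast_ncard_eq,
    ← (Set.toFinite (clSetoid r.classes).classes).cast_ncard_eq, Nat.cast_inj,
    ← finrank_map_degreeSum, ← finrank_levelFunctions]
  exact ⟨Submodule.eq_of_le_of_finrank_eq (map_degreeSum_le r), fun h => by rw [h]⟩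

theorem exists_subalgebra_iff_map_degreeSum_eq (r : Setoid (Irr G)) :
    (∃ A : Subalgebra ℂ (ClassFunction G),
        Subalgebra.toSubmodule A = Submodule.span ℂ (sigma '' r.classes)) ↔
      (Subalgebra.toSubmodule (levelFunctions r)).map degreeSum =
        Subalgebra.toSubmodule (levelFunctions (clSetoid r.classes)) := by
  constructor
  · rintro ⟨A, hA⟩
    have hB : Subalgebra.toSubmodule (A.map (ClassFunction G).val) =
        (Subalgebra.toSubmodule (levelFunctions r)).map degreeSum := by
      rw [← map_span_sigma, ← hA]
      rfl
    refine le_antisymm (map_degreeSum_le r) ?_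
    rw [← hB]
    refine levelFunctions_le_of_separates _ _ ?_ fun g h H => ?_
    · exact Subalgebra.toSubmodule.le_iff_le.1 (hB.trans_le (map_degreeSum_le r))
    · refine (clSetoid_classes_iff r).2 fun a ha => H _ ?_
      rw [← Subalgebra.mem_toSubmodule, hB]
      exact Submodule.mem_map_of_mem ha
  · intro h
    refine ⟨(levelFunctions (clSetoid r.classes)).comap (ClassFunction G).val, ?_⟩
    apply Submodule.map_injective_of_injective
      (f := (ClassFunction G).val.toLinearMap) Subtype.val_injective
    rw [map_span_sigma, h]
    ext f
    constructor
    · rintro ⟨f, hf, rfl⟩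
      exact hf
    · intro hf
      exact ⟨⟨f, levelFunctions_clSetoid_le _ hf⟩, hf, rfl⟩

theorem irSetoid_eq_of_map_degreeSum_eq (r : Setoid (Irr G))
    (h : (Subalgebra.toSubmodule (levelFunctions r)).map degreeSum =
      Subalgebra.toSubmodule (levelFunctions (clSetoid r.classes))) :
    r = irSetoid (clSetoid r.classes).classes := by
  have hN : (Nat.card G : ℂ) ≠ 0 := by simp
  ext χ ψ
  rw [irSetoid_classes_iff]
  constructor
  · intro hr f hf
    have hf' : star f ∈ (Subalgebra.toSubmodule (levelFunctions r)).map degreeSum := by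
      rw [h]
      exact star_mem_levelFunctions hf
    obtain ⟨a, ha, hfa⟩ := hf'
    -- Since `L` is closed under conjugation, `star f` is some `degreeSum a` with `a` constant on
    -- classes of `r`.
    rw [← star_star f, ← hfa, centralValue_star_degreeSum, Pi.smul_apply, Pi.smul_apply,
      star_mem_levelFunctions ha χ ψ hr]
  · intro H
    classical
    -- The conjugate of `σ_X`, for `X` the class of `ψ`, lies in `L`; its central values are `|G|`
    -- times the indicator of `X`, which tells `ψ` from any `χ` outside `X`.
    have hX := indicator_mem_levelFunctions (r.mem_classes ψ)
    have hD : degreeSum ({χ | r χ ψ}.indicator 1) ∈ levelFunctions (clSetoid r.classes) :=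
      map_degreeSum_le r (Submodule.mem_map_of_mem hX)
    have := H _ (star_mem_levelFunctions hD)
    rw [centralValue_star_degreeSum, Pi.smul_apply, Pi.smul_apply, smul_eq_mul, smul_eq_mul,
      mul_right_inj' hN, Pi.star_apply, Pi.star_apply, star_inj] at this
    by_contra hχ
    rw [Set.indicator_of_notMem (by exact hχ), Set.indicator_of_mem (by exact r.refl' ψ)] at this
    exact zero_ne_one this

theorem map_degreeSum_eq_of_irSetoid_eq (r : Setoid (Irr G))
    (h : r = irSetoid (clSetoid r.classes).classes) :
    (Subalgebra.toSubmodule (levelFunctions r)).map degreeSum =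
      Subalgebra.toSubmodule (levelFunctions (clSetoid r.classes)) := by
  refine Submodule.eq_of_le_of_finrank_le (map_degreeSum_le r) ?_
  rw [finrank_map_degreeSum, ← finrank_levelFunctions]
  -- The hypothesis makes `centralValue` map `L` into `levelFunctions r`; its injectivity gives `dim
  -- L ≤ |𝓧| = dim V`.
  let T : Subalgebra.toSubmodule (levelFunctions (clSetoid r.classes)) →ₗ[ℂ]
      Subalgebra.toSubmodule (levelFunctions r) :=
    centralValue.restrict fun f hf χ ψ hr => by
      rw [h] at hr
      exact (irSetoid_classes_iff _).1 hr f hf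
  refine LinearMap.finrank_le_finrank_of_injective (f := T) fun f f' hff => Subtype.ext ?_
  exact centralValue_injOn (levelFunctions_clSetoid_le _ f.2) (levelFunctions_clSetoid_le _ f'.2)
    (congrArg Subtype.val hff)

end

end SCT

theorem mainTheorem3 {G : Type*} [Group G] [Fintype G]
    (𝓧 : Set (Set (SCT.Irr G))) (h𝓧 : Setoid.IsPartition 𝓧) :
    List.TFAE [
      𝓧.encard = (SCT.ClPt 𝓧).encard,
      ∃ A : Subalgebra ℂ (SCT.ClassFunction G),
        Subalgebra.toSubmodule A = Submodule.span ℂ (SCT.sigma '' 𝓧),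
      𝓧 = SCT.IrPt (SCT.ClPt 𝓧)] := by
  obtain ⟨r, rfl⟩ : ∃ r : Setoid (SCT.Irr G), r.classes = 𝓧 :=
    ⟨_, Setoid.classes_mkClasses 𝓧 h𝓧⟩
  have h1 := SCT.encard_eq_iff_map_degreeSum_eq r
  have h2 := SCT.exists_subalgebra_iff_map_degreeSum_eq r
  have h3 : r.classes = SCT.IrPt (SCT.ClPt r.classes) ↔ _ :=
    Setoid.classes_inj.symm.trans
      ⟨SCT.map_degreeSum_eq_of_irSetoid_eq r, SCT.irSetoid_eq_of_map_degreeSum_eq r⟩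
  tfae_have 1 ↔ 2 := h1.trans h2.symm
  tfae_have 1 ↔ 3 := h1.trans h3.symm
  tfae_finish
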